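/- Let $n\geq 3$. The degree sequence of a simple graph $G$ on the vertex set $[n]=\{1,\ldots,n\}$ is the vector $(d_1,\ldots,d_n)\in\mathbb{R}^n$, where $d_j$ is the degree of the vertex $j$ in $G$; the degree partition of $G$ is its degree sequence rearranged in weakly decreasing order. Let $\mathsf{DS}(n)\subseteq\mathbb{R}^n$ be the convex hull of all degree sequences, and $\mathsf{DP}(n)\subseteq\mathbb{R}^n$ the convex hull of all degree partitions, of simple graphs on $[n]$. Then $$\operatorname{vol}(\mathsf{DS}(n)) = n!\cdot\operatorname{vol}(\mathsf{DP}(n)),$$ where $\operatorname{vol}$ is the $n$-dimensional Lebesgue measure. Moreover, $\mathsf{DP}(n)$ is the asymmetric part of $\mathsf{DS}(n)$, both in terms of linear inequalities and in terms of lattice points: $$\mathsf{DP}(n)=\{x\in\mathsf{DS}(n) : x_1\geq x_2\geq\cdots\geq x_n\}=\operatorname{conv}\{x\in\mathsf{DS}(n)\cap\mathbb{N}^n : x_1\geq x_2\geq\cdots\geq x_n\}$$ (with $0\in\mathbb{N}$), and both polytopes are full-dimensional: $\dim\mathsf{DS}(n)=\dim\mathsf{DP}(n)=n$. -/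

import Mathlib

namespace DegreePolytopes

/-- The degree sequence of a simple graph on `n` labelled vertices, as a vector in `ℝⁿ`. -/
noncomputable def degreeSequence {n : ℕ} (G : SimpleGraph (Fin n)) : Fin n → ℝ :=
  open scoped Classical in fun i => (G.degree i : ℝ)

/-- The set of all degree sequences of simple graphs on `n` labelled vertices. -/
def degreeSequences (n : ℕ) : Set (Fin n → ℝ) :=
  {d | ∃ G : SimpleGraph (Fin n), d = degreeSequence G}

/-- The set of all degree partitions: the weakly decreasing rearrangements of degree sequences. -/
def degreePartitions (n : ℕ) : Set (Fin n → ℝ) :=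
  {d | Antitone d ∧
    ∃ (G : SimpleGraph (Fin n)) (σ : Equiv.Perm (Fin n)), d = degreeSequence G ∘ σ}

/-- The polytope of degree sequences. -/
def DS (n : ℕ) : Set (Fin n → ℝ) := convexHull ℝ (degreeSequences n)

/-- The polytope of degree partitions. -/
def DP (n : ℕ) : Set (Fin n → ℝ) := convexHull ℝ (degreePartitions n)

/-- The asymmetric part of `P` in terms of linear inequalities: the inequalities
`x₁ ≥ x₂ ≥ ⋯ ≥ xₙ` are added to those that define `P`. -/
def asymmetricPart {n : ℕ} (P : Set (Fin n → ℝ)) : Set (Fin n → ℝ) :=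
  {x | x ∈ P ∧ Antitone x}

/-- The asymmetric part of `P` in terms of lattice points: the convex hull of the weakly
decreasing points of `P` with natural number coordinates. -/
def latticeAsymmetricPart {n : ℕ} (P : Set (Fin n → ℝ)) : Set (Fin n → ℝ) :=
  convexHull ℝ {x | x ∈ P ∧ (∃ m : Fin n → ℕ, x = fun i => (m i : ℝ)) ∧ Antitone x}

/-- The dimension of a (nonempty) convex set in `ℝⁿ`: the dimension of its affine hull. -/
noncomputable def dim {n : ℕ} (P : Set (Fin n → ℝ)) : ℕ :=
  Module.finrank ℝ (affineSpan ℝ P).direction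

end DegreePolytopes

/-! The crux is `DP_eq_asymmetricPart`. By Hahn-Banach separation it suffices that each functional c
on the antitone part of `DS n` is bounded by its value at some degree partition d. Project c to p in
the antitone cone and let d be the degree sequence of the threshold graph of p. Then c·x ≤ p·x ≤ p·d
≤ c·d: the outer steps are variational inequalities of the projection, the middle one is optimality
of threshold graphs. The lattice version is sandwiched between `DP n` and the antitone part.
Permutation symmetry cuts `DS n` into n! copies of that part up to a null set, which gives the
volume; full dimension of `DP n` then follows from that of `DS n`. -/

namespace DegreePolytopes

open MeasureTheory

/-! ### Symmetry under relabelling -/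

section Permutations

variable {n : ℕ}

theorem degreeSequence_eq_sum (G : SimpleGraph (Fin n)) [DecidableRel G.Adj] (i : Fin n) :
    degreeSequence G i = ∑ j, if G.Adj i j then (1 : ℝ) else 0 := by
  classical
  simp only [degreeSequence, Finset.sum_boole, Nat.cast_inj,
    ← SimpleGraph.card_neighborFinset_eq_degree]
  congr 1
  ext j
  simp

/-- Degree sequences are closed under relabelling the vertices. -/
theorem degreeSequence_comp_perm (G : SimpleGraph (Fin n)) (σ : Equiv.Perm (Fin n)) :
    degreeSequence G ∘ σ = degreeSequence (G.comap σ) := by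
  classical
  ext i
  simp only [Function.comp_apply, degreeSequence_eq_sum, SimpleGraph.comap_adj]
  exact (Equiv.sum_comp σ fun j => if G.Adj (σ i) j then (1 : ℝ) else 0).symm

theorem degreePartitions_eq :
    degreePartitions n = {d | d ∈ degreeSequences n ∧ Antitone d} := by
  ext d
  constructor
  · rintro ⟨hd, G, σ, rfl⟩
    exact ⟨⟨_, degreeSequence_comp_perm G σ⟩, hd⟩
  · rintro ⟨⟨G, rfl⟩, hd⟩
    exact ⟨hd, G, Equiv.refl _, rfl⟩

theorem finite_degreeSequences : (degreeSequences n).Finite :=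
  (Set.finite_range (degreeSequence (n := n))).subset fun _ ⟨G, hG⟩ => ⟨G, hG.symm⟩

theorem degreePartitions_subset : degreePartitions n ⊆ degreeSequences n := by
  rw [degreePartitions_eq]
  exact fun _ h => h.1

theorem isClosed_DP : IsClosed (DP n) :=
  (finite_degreeSequences.subset degreePartitions_subset).isClosed_convexHull ℝ

theorem isClosed_DS : IsClosed (DS n) := finite_degreeSequences.isClosed_convexHull ℝ

theorem comp_perm_mem_DS {x : Fin n → ℝ} (hx : x ∈ DS n) (σ : Equiv.Perm (Fin n)) :
    x ∘ σ ∈ DS n := by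
  have h : DS n ⊆ (LinearMap.funLeft ℝ ℝ σ) ⁻¹' DS n := by
    refine convexHull_min ?_ ((convex_convexHull ℝ _).linear_preimage _)
    rintro _ ⟨G, rfl⟩
    exact subset_convexHull ℝ _ ⟨_, degreeSequence_comp_perm G σ⟩
  exact h hx

theorem comp_perm_mem_DS_iff {x : Fin n → ℝ} (σ : Equiv.Perm (Fin n)) :
    x ∘ σ ∈ DS n ↔ x ∈ DS n := by
  refine ⟨fun h => ?_, fun h => comp_perm_mem_DS h σ⟩
  simpa [Function.comp_assoc] using comp_perm_mem_DS h σ.symm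

end Permutations

/-! ### Threshold graphs as maximizers -/

section Threshold

variable {n : ℕ}

/-- The threshold graph with vertex weights `c`. -/
def thresholdGraph (c : Fin n → ℝ) : SimpleGraph (Fin n) where
  Adj i j := i ≠ j ∧ 0 < c i + c j
  symm := ⟨fun i j h => ⟨h.1.symm, by rw [add_comm]; exact h.2⟩⟩
  loopless := ⟨fun _ h => h.1 rfl⟩

/-- Swapping i and j carries the neighbours of j into those of i. In particular, equal weights give
equal degrees. -/
theorem degreeSequence_thresholdGraph_mono {c : Fin n → ℝ} {i j : Fin n} (h : c j ≤ c i) :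
    degreeSequence (thresholdGraph c) j ≤ degreeSequence (thresholdGraph c) i := by
  classical
  rw [degreeSequence_eq_sum, degreeSequence_eq_sum, ← Equiv.sum_comp (Equiv.swap i j)]
  refine Finset.sum_le_sum fun k _ => ?_
  have key : (thresholdGraph c).Adj j (Equiv.swap i j k) → (thresholdGraph c).Adj i k := by
    rcases eq_or_ne k i with rfl | hki
    · simp
    rcases eq_or_ne k j with rfl | hkj
    · simpa using fun h => h.symm
    rw [Equiv.swap_apply_of_ne_of_ne hki hkj]
    exact fun h' => ⟨hki.symm, by linarith [h'.2]⟩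
  split_ifs with h₁ h₂
  exacts [le_rfl, absurd (key h₁) h₂, zero_le_one, le_rfl]

/-- Weighted handshake: a maximizer should take exactly the pairs with positive weight sum. -/
theorem sum_mul_degreeSequence (c : Fin n → ℝ) (G : SimpleGraph (Fin n)) [DecidableRel G.Adj] :
    2 * ∑ i, c i * degreeSequence G i
      = ∑ i, ∑ j, if G.Adj i j then c i + c j else 0 := by
  have h₁ : ∑ i, c i * degreeSequence G i = ∑ i, ∑ j, if G.Adj i j then c i else 0 := by
    simp only [degreeSequence_eq_sum, Finset.mul_sum, mul_ite, mul_one, mul_zero]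
  have h₂ : ∑ i, c i * degreeSequence G i = ∑ i, ∑ j, if G.Adj i j then c j else 0 := by
    rw [h₁, Finset.sum_comm]
    simp only [G.adj_comm]
  rw [two_mul]
  nth_rewrite 1 [h₁]
  rw [h₂, ← Finset.sum_add_distrib]
  refine Finset.sum_congr rfl fun i _ => ?_
  rw [← Finset.sum_add_distrib]
  refine Finset.sum_congr rfl fun j _ => ?_
  split_ifs <;> simp

/-- The threshold graph with weights `c` maximizes the linear functional `c` over `DS n`. -/
theorem sum_mul_le_thresholdGraph (c : Fin n → ℝ) {x : Fin n → ℝ} (hx : x ∈ DS n) :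
    ∑ i, c i * x i ≤ ∑ i, c i * degreeSequence (thresholdGraph c) i := by
  classical
  have hsub : DS n ⊆
      {y | ∑ i, c i * y i ≤ ∑ i, c i * degreeSequence (thresholdGraph c) i} := by
    refine convexHull_min ?_ (convex_halfSpace_le ?_ _)
    · rintro _ ⟨G, rfl⟩
      rw [Set.mem_ofPred_eq, ← mul_le_mul_iff_right₀ (zero_lt_two' ℝ), sum_mul_degreeSequence,
        sum_mul_degreeSequence]
      refine Finset.sum_le_sum fun i _ => Finset.sum_le_sum fun j _ => ?_
      by_cases hG : G.Adj i j
      · by_cases hc : 0 < c i + c j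
        · have : (thresholdGraph c).Adj i j := ⟨hG.ne, hc⟩
          simp [hG, this]
        · have : ¬ (thresholdGraph c).Adj i j := fun h => hc h.2
          simpa [hG, this] using hc
      · rw [if_neg hG]
        split_ifs with h
        exacts [h.2.le, le_rfl]
    · exact ⟨fun x y => by simp [mul_add, Finset.sum_add_distrib],
        fun a x => by simp [Finset.mul_sum, mul_left_comm]⟩
  exact hsub hx

end Threshold

/-! ### The antitone part and its supporting functionals -/

section Antitone

variable {n : ℕ}

theorem convex_setOf_antitone : Convex ℝ {x : Fin n → ℝ | Antitone x} := by
  intro x hx y hy a b ha hb _ i j hij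
  have h₁ := mul_le_mul_of_nonneg_left (hx hij) ha
  have h₂ := mul_le_mul_of_nonneg_left (hy hij) hb
  simpa using add_le_add h₁ h₂

theorem isClosed_setOf_antitone : IsClosed {x : Fin n → ℝ | Antitone x} := by
  simp only [Antitone, Set.ofPred_forall]
  exact isClosed_iInter fun i => isClosed_iInter fun j => isClosed_iInter fun _ =>
    isClosed_le (continuous_apply j) (continuous_apply i)

/-- The nearest point to `c` in the cone of antitone vectors, with its variational inequality. -/
theorem exists_antitone_projection (c : Fin n → ℝ) :
    ∃ p : Fin n → ℝ, Antitone p ∧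
      ∀ w : Fin n → ℝ, Antitone w → ∑ i, (c i - p i) * (w i - p i) ≤ 0 := by
  let K : Set (EuclideanSpace ℝ (Fin n)) :=
    (EuclideanSpace.equiv (Fin n) ℝ) ⁻¹' {x | Antitone x}
  have hconv : Convex ℝ K :=
    convex_setOf_antitone.linear_preimage (EuclideanSpace.equiv (Fin n) ℝ).toLinearMap
  have hclosed : IsClosed K :=
    isClosed_setOf_antitone.preimage (EuclideanSpace.equiv (Fin n) ℝ).continuous
  have hne : K.Nonempty := ⟨0, fun _ _ _ => le_rfl⟩
  obtain ⟨v, hv, hmin⟩ := exists_norm_eq_iInf_of_complete_convex hne hclosed.isComplete hconv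
    (WithLp.toLp 2 c)
  refine ⟨fun i => v i, hv, fun w hw => ?_⟩
  have h := (norm_eq_iInf_iff_real_inner_le_zero hconv hv).1 hmin (WithLp.toLp 2 w) hw
  simpa [PiLp.inner_apply, mul_comm] using h

/-- If the coordinates of `d` are a function of those of the antitone vector `p`, then
`p - ε d` is antitone for some `ε > 0`. -/
theorem exists_pos_antitone_sub {p d : Fin n → ℝ} (hp : Antitone p)
    (hd : ∀ i j, p j = p i → d j = d i) :
    ∃ ε > 0, Antitone fun i => p i - ε * d i := by
  have h : ∀ i j : Fin n, i ≤ j → ∀ᶠ ε in nhdsWithin (0 : ℝ) (Set.Ioi 0),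
      p j - ε * d j ≤ p i - ε * d i := by
    intro i j hij
    rcases (hp hij).eq_or_lt with heq | hlt
    · simp [heq, hd i j heq]
    · refine Filter.Eventually.filter_mono nhdsWithin_le_nhds ?_
      have hc : Continuous fun ε : ℝ => (p i - ε * d i) - (p j - ε * d j) := by fun_prop
      have := hc.tendsto 0 |>.eventually_const_lt (u := 0) (by simpa using hlt)
      filter_upwards [this] with ε hε
      linarith
  have h' : ∀ᶠ ε in nhdsWithin (0 : ℝ) (Set.Ioi 0), Antitone fun i => p i - ε * d i := by
    simp only [Antitone]
    refine Filter.eventually_all.2 fun i => Filter.eventually_all.2 fun j => ?_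
    exact Filter.eventually_imp_distrib_left.2 fun hij => h i j hij
  obtain ⟨ε, hε, hpos⟩ := (h'.and self_mem_nhdsWithin).exists
  exact ⟨ε, hpos, hε⟩

/-- Every linear functional on the antitone part of `DS n` is bounded by its value at some degree
partition, namely at the threshold graph of its projection to the antitone cone. -/
theorem exists_degreePartition_ge (c : Fin n → ℝ) :
    ∃ d ∈ degreePartitions n, ∀ x ∈ DS n, Antitone x → ∑ i, c i * x i ≤ ∑ i, c i * d i := by
  obtain ⟨p, hp, hproj⟩ := exists_antitone_projection c
  set d := degreeSequence (thresholdGraph p) with hd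
  have hmono : ∀ i j, p j ≤ p i → d j ≤ d i := fun i j h => degreeSequence_thresholdGraph_mono h
  refine ⟨d, ?_, fun x hx hanti => ?_⟩
  · rw [degreePartitions_eq]
    exact ⟨⟨_, rfl⟩, fun i j hij => hmono i j (hp hij)⟩
  -- The cone is closed under addition, so p + x is a valid test point.
  have hcx : ∑ i, (c i - p i) * x i ≤ 0 := by
    simpa using hproj (p + x) (hp.add hanti)
  have hpx : ∑ i, p i * x i ≤ ∑ i, p i * d i := sum_mul_le_thresholdGraph p hx
  obtain ⟨ε, hε, hanti'⟩ := exists_pos_antitone_sub hp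
    fun i j h => le_antisymm (hmono i j h.le) (hmono j i h.ge)
  -- Since d is constant where p is, p can also move slightly in direction -d within the cone.
  have hcd : 0 ≤ ∑ i, (c i - p i) * d i := by
    have h := hproj _ hanti'
    have heq : ∑ i, (c i - p i) * (p i - ε * d i - p i) = -(ε * ∑ i, (c i - p i) * d i) := by
      rw [Finset.mul_sum, ← Finset.sum_neg_distrib]
      exact Finset.sum_congr rfl fun i _ => by ring
    rw [heq, neg_nonpos] at h
    exact nonneg_of_mul_nonneg_right h hε
  simp only [sub_mul, Finset.sum_sub_distrib] at hcx hcd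
  linarith

theorem DP_subset_asymmetricPart : DP n ⊆ asymmetricPart (DS n) := by
  refine convexHull_min ?_ ((convex_convexHull ℝ _).inter convex_setOf_antitone)
  exact fun d hd => ⟨subset_convexHull ℝ _ (degreePartitions_subset hd), hd.1⟩

theorem DP_eq_asymmetricPart : DP n = asymmetricPart (DS n) := by
  refine DP_subset_asymmetricPart.antisymm fun x ⟨hx, hanti⟩ => ?_
  by_contra hxP
  obtain ⟨f, u, hf, hu⟩ := geometric_hahn_banach_closed_point (convex_convexHull ℝ _)
    isClosed_DP hxP
  have hrepr : ∀ y : Fin n → ℝ, f y = ∑ i, f (Pi.single i 1) * y i := fun y => by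
    conv_lhs => rw [pi_eq_sum_univ' y]
    simp only [map_sum, map_smul, smul_eq_mul]
    refine Finset.sum_congr rfl fun i _ => ?_
    rw [mul_comm]
  obtain ⟨d, hd, hmax⟩ := exists_degreePartition_ge fun i => f (Pi.single i 1)
  have h₁ := hmax x hx hanti
  rw [← hrepr, ← hrepr] at h₁
  exact absurd (hf d (subset_convexHull ℝ _ hd)) (not_lt.2 (hu.le.trans h₁))

theorem DP_eq_latticeAsymmetricPart : DP n = latticeAsymmetricPart (DS n) := by
  apply Set.Subset.antisymm
  · refine convexHull_mono ?_
    rw [degreePartitions_eq]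
    rintro _ ⟨⟨G, rfl⟩, hanti⟩
    exact ⟨subset_convexHull ℝ _ ⟨G, rfl⟩, ⟨_, rfl⟩, hanti⟩
  · refine convexHull_min ?_ (convex_convexHull ℝ _)
    intro x hx
    rw [DP_eq_asymmetricPart]
    exact ⟨hx.1, hx.2.2⟩

end Antitone

/-! ### Decomposition into n! chambers -/

section Volume

variable {n : ℕ}

theorem volume_setOf_apply_eq {i j : Fin n} (hij : i ≠ j) :
    volume {x : Fin n → ℝ | x i = x j} = 0 := by
  let S : Submodule ℝ (Fin n → ℝ) :=
    LinearMap.ker (LinearMap.proj (R := ℝ) (φ := fun _ => ℝ) i - LinearMap.proj j)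
  have hS : {x : Fin n → ℝ | x i = x j} = S := by
    ext x
    simp [S, sub_eq_zero]
  rw [hS]
  refine Measure.addHaar_submodule volume S fun h => ?_
  have : (Pi.single i 1 : Fin n → ℝ) ∈ S := h ▸ Submodule.mem_top
  simp [S, hij.symm] at this

theorem ae_injective : ∀ᵐ x : Fin n → ℝ, Function.Injective x := by
  have h : ∀ᵐ x : Fin n → ℝ, ∀ i j : Fin n, i ≠ j → x i ≠ x j := by
    refine ae_all_iff.2 fun i => ae_all_iff.2 fun j => ?_
    rcases eq_or_ne i j with rfl | hij
    · simp
    · simpa [ae_iff, hij] using volume_setOf_apply_eq hij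
  filter_upwards [h] with x hx i j hij
  by_contra hne
  exact hx i j hne hij

theorem isOpen_setOf_strictAnti : IsOpen {x : Fin n → ℝ | StrictAnti x} := by
  simp only [StrictAnti, Set.ofPred_forall]
  exact isOpen_iInter_of_finite fun i => isOpen_iInter_of_finite fun j =>
    isOpen_iInter_of_finite fun _ => isOpen_lt (continuous_apply j) (continuous_apply i)

theorem measurePreserving_comp_perm (σ : Equiv.Perm (Fin n)) :
    MeasurePreserving (fun x : Fin n → ℝ => x ∘ σ) := by
  have h : (fun x : Fin n → ℝ => x ∘ σ) =
      MeasurableEquiv.piCongrLeft (fun _ : Fin n => ℝ) σ.symm := by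
    ext x i
    simp [MeasurableEquiv.coe_piCongrLeft, Equiv.piCongrLeft_apply]
  rw [h]
  exact volume_measurePreserving_piCongrLeft (fun _ : Fin n => ℝ) σ.symm

theorem exists_perm_strictAnti {x : Fin n → ℝ} (hx : Function.Injective x) :
    ∃ σ : Equiv.Perm (Fin n), StrictAnti (x ∘ σ) := by
  -- `Tuple.sort` sorts increasingly, hence the negation.
  refine ⟨Tuple.sort (-x), Antitone.strictAnti_of_injective (fun i j hij => ?_)
    (hx.comp (Equiv.injective _))⟩
  simpa using Tuple.monotone_sort (-x) hij

theorem perm_eq_of_strictAnti {x : Fin n → ℝ} {σ τ : Equiv.Perm (Fin n)}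
    (hσ : StrictAnti (x ∘ σ)) (hτ : StrictAnti (x ∘ τ)) : σ = τ := by
  have hinj : Function.Injective x := by
    simpa [Function.comp_assoc] using hσ.injective.comp σ.symm.injective
  have h : (-x) ∘ σ = (-x) ∘ τ := Tuple.unique_monotone
    (fun i j hij => by simpa using hσ.antitone hij) (fun i j hij => by simpa using hτ.antitone hij)
  ext i
  exact congrArg Fin.val (hinj (by simpa using congrFun h i))

/-- A measurable set invariant under coordinate permutations consists, up to a null set, of `n!`
congruent copies of its antitone part. -/
theorem volume_eq_factorial_mul_volume_asymmetricPart {P : Set (Fin n → ℝ)}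
    (hP : MeasurableSet P) (hsymm : ∀ (σ : Equiv.Perm (Fin n)) x, x ∘ σ ∈ P ↔ x ∈ P) :
    volume P = (n.factorial : ENNReal) * volume (asymmetricPart P) := by
  let Q : Set (Fin n → ℝ) := P ∩ {x | StrictAnti x}
  have hQ : MeasurableSet Q := hP.inter isOpen_setOf_strictAnti.measurableSet
  have hQP : volume (asymmetricPart P) = volume Q := by
    refine measure_congr ?_
    filter_upwards [ae_injective] with x hx
    refine propext (and_congr_right fun _ => ⟨fun h => ?_, fun h => ?_⟩)
    · exact Antitone.strictAnti_of_injective h hx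
    · exact StrictAnti.antitone h
  let F : Equiv.Perm (Fin n) → Set (Fin n → ℝ) := fun σ => (fun x => x ∘ σ) ⁻¹' Q
  have hunion : volume P = volume (⋃ σ ∈ Finset.univ, F σ) := by
    refine measure_congr ?_
    filter_upwards [ae_injective] with x hx
    refine propext ⟨fun h => ?_, fun h => ?_⟩
    · obtain ⟨σ, hσ⟩ := exists_perm_strictAnti hx
      exact Set.mem_biUnion (Finset.mem_coe.2 (Finset.mem_univ σ)) ⟨(hsymm σ x).2 h, hσ⟩
    · obtain ⟨σ, -, hσ⟩ := Set.mem_iUnion₂.1 h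
      exact (hsymm σ x).1 hσ.1
  rw [hunion, measure_biUnion_finset, hQP]
  · simp [F, fun σ => (measurePreserving_comp_perm (n := n) σ).measure_preimage
      hQ.nullMeasurableSet, Fintype.card_perm]
  · intro σ _ τ _ hne
    refine Set.disjoint_left.2 fun x hσ hτ => hne (perm_eq_of_strictAnti hσ.2 hτ.2)
  · exact fun σ _ => (measurePreserving_comp_perm σ).measurable hQ

theorem volume_DS : volume (DS n) = (n.factorial : ENNReal) * volume (DP n) := by
  rw [DP_eq_asymmetricPart]
  exact volume_eq_factorial_mul_volume_asymmetricPart isClosed_DS.measurableSet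
    fun σ _ => comp_perm_mem_DS_iff σ

end Volume

/-! ### Full dimensionality -/

section Dimension

variable {n : ℕ}

theorem degreeSequence_edge {i j : Fin n} (hij : i ≠ j) :
    degreeSequence (SimpleGraph.edge i j) = Pi.single i 1 + Pi.single j 1 := by
  classical
  ext k
  rw [degreeSequence_eq_sum]
  simp only [SimpleGraph.edge_adj, Pi.add_apply, Pi.single_apply]
  rcases eq_or_ne k i with rfl | hki
  · rw [Finset.sum_eq_single j] <;> simp +contextual [hij, eq_comm]
  rcases eq_or_ne k j with rfl | hkj
  · rw [Finset.sum_eq_single i] <;> simp +contextual [hki, eq_comm]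
  · simp [hki, hkj]

theorem affineSpan_DS (hn : 3 ≤ n) : affineSpan ℝ (DS n) = ⊤ := by
  have h0 : (0 : Fin n → ℝ) ∈ degreeSequences n := by
    classical
    refine ⟨⊥, ?_⟩
    ext i
    simp [degreeSequence_eq_sum]
  rw [DS, affineSpan_convexHull,
    AffineSubspace.affineSpan_eq_top_iff_vectorSpan_eq_top_of_nonempty ℝ _ _ ⟨0, h0⟩, eq_top_iff]
  have hedge : ∀ {i j : Fin n}, i ≠ j →
      (Pi.single i 1 + Pi.single j 1 : Fin n → ℝ) ∈ vectorSpan ℝ (degreeSequences n) := by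
    intro i j hij
    have hmem : (Pi.single i 1 + Pi.single j 1 : Fin n → ℝ) ∈ degreeSequences n :=
      ⟨_, (degreeSequence_edge hij).symm⟩
    simpa using vsub_mem_vectorSpan ℝ hmem h0
  have hsingle : ∀ i : Fin n,
      (Pi.single i 1 : Fin n → ℝ) ∈ vectorSpan ℝ (degreeSequences n) := by
    intro i
    obtain ⟨j, hj⟩ : ∃ j, j ∉ ({i} : Finset (Fin n)) :=
      Finset.exists_mem_notMem_of_card_lt_card (s := {i}) (t := Finset.univ)
        (by simp; omega) |>.imp fun _ h => h.2
    obtain ⟨k, hk⟩ : ∃ k, k ∉ ({i, j} : Finset (Fin n)) :=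
      Finset.exists_mem_notMem_of_card_lt_card (s := {i, j}) (t := Finset.univ)
        (Finset.card_le_two.trans_lt (by simp; omega)) |>.imp fun _ h => h.2
    simp only [Finset.mem_insert, Finset.mem_singleton, not_or] at hj hk
    -- The triangle i, j, k gives e_i = ½((e_i + e_j) + (e_i + e_k) - (e_j + e_k)).
    have h := Submodule.smul_mem _ (1 / 2 : ℝ) (Submodule.sub_mem _
      (Submodule.add_mem _ (hedge (Ne.symm hj)) (hedge (Ne.symm hk.1))) (hedge (Ne.symm hk.2)))
    convert h using 1
    module
  intro x _
  rw [pi_eq_sum_univ' x]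
  refine Submodule.sum_mem _ fun i _ => Submodule.smul_mem _ _ ?_
  exact hsingle i

/-- A proper affine subspace is null, so `volume_DS` would make `DS n` null despite its nonempty
interior. -/
theorem affineSpan_DP (hn : 3 ≤ n) : affineSpan ℝ (DP n) = ⊤ := by
  by_contra hne
  have hDP : volume (DP n) = 0 := measure_mono_null (subset_affineSpan ℝ _)
    (Measure.addHaar_affineSubspace volume _ hne)
  have hDS : volume (DS n) = 0 := by rw [volume_DS, hDP, mul_zero]
  have hint : (interior (DS n)).Nonempty :=
    ((convex_convexHull ℝ _).interior_nonempty_iff_affineSpan_eq_top).2 (affineSpan_DS hn)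
  exact (Measure.measure_pos_of_nonempty_interior volume hint).ne' hDS

theorem dim_eq_of_affineSpan_eq_top {P : Set (Fin n → ℝ)} (h : affineSpan ℝ P = ⊤) :
    dim P = n := by
  rw [dim, h, AffineSubspace.direction_top, finrank_top, Module.finrank_fin_fun]

end Dimension

end DegreePolytopes

theorem mainTheorem2 (n : ℕ) (hn : 3 ≤ n) :
    MeasureTheory.volume (DegreePolytopes.DS n)
        = (Nat.factorial n : ENNReal) * MeasureTheory.volume (DegreePolytopes.DP n) ∧
      DegreePolytopes.DP n = DegreePolytopes.asymmetricPart (DegreePolytopes.DS n) ∧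
      DegreePolytopes.DP n = DegreePolytopes.latticeAsymmetricPart (DegreePolytopes.DS n) ∧
      DegreePolytopes.dim (DegreePolytopes.DS n) = n ∧
      DegreePolytopes.dim (DegreePolytopes.DP n) = n :=
  ⟨DegreePolytopes.volume_DS, DegreePolytopes.DP_eq_asymmetricPart,
    DegreePolytopes.DP_eq_latticeAsymmetricPart,
    DegreePolytopes.dim_eq_of_affineSpan_eq_top (DegreePolytopes.affineSpan_DS hn),
    DegreePolytopes.dim_eq_of_affineSpan_eq_top (DegreePolytopes.affineSpan_DP hn)⟩
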